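/- Let $k$ be a field, let $A$ and $B$ be $k$-algebras (associative and unital), and let $M$ be a $B$-$A$-bimodule on which $k$ acts centrally. Let $$\Lambda=\begin{pmatrix}A&0\\ M&B\end{pmatrix}$$ be the corresponding corner algebra, with multiplication $\begin{pmatrix}a&0\\ m&b\end{pmatrix}\begin{pmatrix}a'&0\\ m'&b'\end{pmatrix}=\begin{pmatrix}aa'&0\\ ma'+bm'&bb'\end{pmatrix}$. Call a $k$-algebra smooth if it is finite dimensional over $k$ and has finite global dimension, the global dimension being the supremum of the projective dimensions of all left modules. If $\Lambda$ is finite dimensional over $k$ and $A$ and $B$ are smooth, then $\Lambda$ is smooth. -/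

import Mathlib

open CategoryTheory

universe u v

/-- The left global dimension of a ring `R`: the supremum of the projective dimensions
of all left `R`-modules. -/
noncomputable def leftGlobalDimension (R : Type u) [Ring R] : WithBot ℕ∞ :=
  ⨆ X : ModuleCat.{u} R, projectiveDimension X

/-- A smooth algebra over a field `k`: finite dimensional and of finite global dimension. -/
structure IsSmoothAlgebra (k : Type v) [Field k] (R : Type u) [Ring R] [Algebra k R] : Prop where
  finiteDimensional : FiniteDimensional k R
  globalDimension_lt_top : leftGlobalDimension R < ⊤

/-- The matrices `!![a, 0; m, b]` with `a : A`, `m : M`, `b : B`. -/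
@[ext]
structure CornerAlgebra (A B M : Type u) where
  a : A
  m : M
  b : B

namespace CornerAlgebra

set_option linter.unusedSectionVars false

section AddCommGroup

variable {A B M : Type u} [AddCommGroup A] [AddCommGroup B] [AddCommGroup M]

instance : Zero (CornerAlgebra A B M) := ⟨⟨0, 0, 0⟩⟩
instance : Add (CornerAlgebra A B M) := ⟨fun x y => ⟨x.a + y.a, x.m + y.m, x.b + y.b⟩⟩
instance : Neg (CornerAlgebra A B M) := ⟨fun x => ⟨-x.a, -x.m, -x.b⟩⟩

@[simp] theorem a_zero : (0 : CornerAlgebra A B M).a = 0 := rfl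
@[simp] theorem m_zero : (0 : CornerAlgebra A B M).m = 0 := rfl
@[simp] theorem b_zero : (0 : CornerAlgebra A B M).b = 0 := rfl
@[simp] theorem a_add (x y : CornerAlgebra A B M) : (x + y).a = x.a + y.a := rfl
@[simp] theorem m_add (x y : CornerAlgebra A B M) : (x + y).m = x.m + y.m := rfl
@[simp] theorem b_add (x y : CornerAlgebra A B M) : (x + y).b = x.b + y.b := rfl
@[simp] theorem a_neg (x : CornerAlgebra A B M) : (-x).a = -x.a := rfl
@[simp] theorem m_neg (x : CornerAlgebra A B M) : (-x).m = -x.m := rfl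
@[simp] theorem b_neg (x : CornerAlgebra A B M) : (-x).b = -x.b := rfl

instance instAddCommGroup : AddCommGroup (CornerAlgebra A B M) where
  add_assoc x y z := by ext <;> simp [add_assoc]
  zero_add x := by ext <;> simp
  add_zero x := by ext <;> simp
  add_comm x y := by ext <;> simp [add_comm]
  neg_add_cancel x := by ext <;> simp
  nsmul := nsmulRec
  zsmul := zsmulRec

instance {k : Type v} [SMul k A] [SMul k B] [SMul k M] : SMul k (CornerAlgebra A B M) :=
  ⟨fun c x => ⟨c • x.a, c • x.m, c • x.b⟩⟩

section

variable {k : Type v} [SMul k A] [SMul k B] [SMul k M]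

@[simp] theorem a_smul (c : k) (x : CornerAlgebra A B M) : (c • x).a = c • x.a := rfl
@[simp] theorem m_smul (c : k) (x : CornerAlgebra A B M) : (c • x).m = c • x.m := rfl
@[simp] theorem b_smul (c : k) (x : CornerAlgebra A B M) : (c • x).b = c • x.b := rfl

end

instance instModule {k : Type v} [Field k] [Module k A] [Module k B] [Module k M] :
    Module k (CornerAlgebra A B M) where
  one_smul x := by ext <;> simp
  mul_smul c d x := by ext <;> simp [mul_smul]
  smul_zero c := by ext <;> simp
  smul_add c x y := by ext <;> simp
  add_smul c d x := by ext <;> simp [add_smul]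
  zero_smul x := by ext <;> simp

end AddCommGroup

section Ring

open MulOpposite

variable {A B M : Type u} [Ring A] [Ring B] [AddCommGroup M] [Module B M] [Module Aᵐᵒᵖ M]

instance : One (CornerAlgebra A B M) := ⟨⟨1, 0, 1⟩⟩

/-- Matrix multiplication: the lower left entry of the product of `!![a, 0; m, b]` and
`!![a', 0; m', b']` is `m a' + b m'`. -/
instance : Mul (CornerAlgebra A B M) :=
  ⟨fun x y => ⟨x.a * y.a, op y.a • x.m + x.b • y.m, x.b * y.b⟩⟩

@[simp] theorem a_one : (1 : CornerAlgebra A B M).a = 1 := rfl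
@[simp] theorem m_one : (1 : CornerAlgebra A B M).m = 0 := rfl
@[simp] theorem b_one : (1 : CornerAlgebra A B M).b = 1 := rfl
@[simp] theorem a_mul (x y : CornerAlgebra A B M) : (x * y).a = x.a * y.a := rfl
@[simp] theorem m_mul (x y : CornerAlgebra A B M) :
    (x * y).m = op y.a • x.m + x.b • y.m := rfl
@[simp] theorem b_mul (x y : CornerAlgebra A B M) : (x * y).b = x.b * y.b := rfl

instance instRing [SMulCommClass B Aᵐᵒᵖ M] : Ring (CornerAlgebra A B M) where
  __ := (inferInstance : AddCommGroup (CornerAlgebra A B M))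
  left_distrib x y z := by ext <;> simp [mul_add, add_smul, add_add_add_comm]
  right_distrib x y z := by ext <;> simp [add_mul, add_smul, add_add_add_comm]
  zero_mul x := by ext <;> simp
  mul_zero x := by ext <;> simp
  mul_assoc x y z := by
    ext <;> simp [mul_assoc, mul_smul, smul_comm, add_assoc]
  one_mul x := by ext <;> simp
  mul_one x := by ext <;> simp
  zsmul := zsmulRec

instance instAlgebra {k : Type v} [Field k] [Algebra k A] [Algebra k B] [Module k M]
    [SMulCommClass B Aᵐᵒᵖ M] [IsScalarTower k B M] [IsScalarTower k Aᵐᵒᵖ M] :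
    Algebra k (CornerAlgebra A B M) :=
  Algebra.ofModule
    (fun c x y => by
      ext
      · simp
      · have h' : op y.a • c • x.m = c • op y.a • x.m := by
          rw [← one_smul Aᵐᵒᵖ x.m, ← smul_assoc c (1 : Aᵐᵒᵖ), ← mul_smul, mul_smul_comm,
            smul_assoc, mul_smul]
        simp [h']
      · simp)
    (fun c x y => by
      ext
      · simp
      · have h : x.b • c • y.m = c • x.b • y.m := by
          rw [← one_smul B y.m, ← smul_assoc c (1 : B), ← mul_smul, mul_smul_comm,
            smul_assoc, mul_smul]
        have h' : (c • op y.a) • x.m = c • op y.a • x.m := smul_assoc c (op y.a) x.m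
        simp [h, h']
      · simp)

end Ring

end CornerAlgebra

/-! Let `e = ⟨1, 0, 0⟩` and let `X` be a module over the corner algebra `Λ`. The elements killed by
`e` form a submodule (`lowerPart`) on which `Λ` acts through `B`, and on the quotient `Λ` acts
through `A`; so it suffices to bound projective dimensions over `Λ` of modules restricted from `B`
and from `A`. Restriction from `B` preserves projectives, since `B` is the column `Λ(1 - e)`. The
kernel of `Λ → A` is a `B`-module, so `A` has dimension at most one more than the bound for `B`. If
`n` and `m` are strict bounds for `B` and `A`, shifting along projective resolutions gives the
strict bound `n + m` for `Λ`. -/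

section ProjectiveDimension

variable {R S : Type u} [Ring R] [Ring S] (f : R →+* S)

theorem leftGlobalDimension_lt_top_iff :
    leftGlobalDimension R < ⊤ ↔
      ∃ n : ℕ, ∀ X : ModuleCat.{u} R, HasProjectiveDimensionLT X n := by
  constructor
  · intro h
    have key : ∃ n : ℕ, leftGlobalDimension R < n := by
      generalize leftGlobalDimension R = d at h
      induction d with
      -- The value `⊥` occurs when every module is zero, that is, for the zero ring.
      | bot => exact ⟨0, WithBot.bot_lt_coe _⟩
      | coe d =>
        induction d with
        | top => exact absurd h (lt_irrefl _)
        | coe d => exact ⟨d + 1, by exact_mod_cast Nat.lt_succ_self d⟩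
    obtain ⟨n, hn⟩ := key
    exact ⟨n, fun X => projectiveDimension_lt_iff.1 ((le_iSup _ X).trans_lt hn)⟩
  · rintro ⟨n, hn⟩
    refine lt_of_le_of_lt (iSup_le fun X => (projectiveDimension_lt_iff.2 (hn X)).le) ?_
    exact WithBot.coe_lt_coe.2 (ENat.natCast_lt_top n)

theorem ModuleCat.restrictScalars_map_shortExact {T : ShortComplex (ModuleCat.{u} S)}
    (hT : T.ShortExact) : (T.map (ModuleCat.restrictScalars f)).ShortExact :=
  ModuleCat.shortComplex_shortExact _
    ((ShortComplex.ShortExact.moduleCat_exact_iff_function_exact T).1 hT.exact)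
    hT.moduleCat_injective_f hT.moduleCat_surjective_g

/-- If restriction of scalars sends projectives to modules of projective dimension at most `d`,
then it raises the projective dimension by at most `d`. -/
theorem hasProjectiveDimensionLT_restrictScalars {d : ℕ}
    (h : ∀ P : ModuleCat.{u} S, Projective P →
      HasProjectiveDimensionLT ((ModuleCat.restrictScalars f).obj P) (d + 1)) (n : ℕ)
    (X : ModuleCat.{u} S) (hX : HasProjectiveDimensionLT X n) :
    HasProjectiveDimensionLT ((ModuleCat.restrictScalars f).obj X) (d + n) := by
  induction n generalizing X with
  | zero =>
    have := ((ModuleCat.restrictScalars f).map_isZero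
      (isZero_of_hasProjectiveDimensionLT_zero X)).hasProjectiveDimensionLT_zero
    exact hasProjectiveDimensionLT_of_ge _ 0 _ (Nat.zero_le _)
  | succ n ih =>
    -- Dimension shifting to the syzygy only starts at the strict bound 2; the bound 1 means
    -- projective, which is the hypothesis `h`.
    rcases n with _ | n
    · exact h X (projective_iff_hasProjectiveDimensionLT_one.2 hX)
    · have hT := X.shortExact_projectiveShortComplex
      have h₂ := h X.projectiveShortComplex.X₂ inferInstance
      refine (ModuleCat.restrictScalars_map_shortExact f hT).hasProjectiveDimensionLT_X₃ (d + (n + 1))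
        (ih _ ((hT.hasProjectiveDimensionLT_X₃_iff n inferInstance).1 hX)) ?_
      exact @hasProjectiveDimensionLT_of_ge _ _ _ _ (d + 1) _ (by lia) h₂

/-- A module killed by the kernel of a surjective ring homomorphism comes from the quotient. -/
theorem exists_restrictScalars_iso (hf : Function.Surjective f) (X : ModuleCat.{u} R)
    (hX : ∀ r, f r = 0 → ∀ x : X, r • x = 0) :
    ∃ Y : ModuleCat.{u} S, Nonempty ((ModuleCat.restrictScalars f).obj Y ≅ X) := by
  let φ : S →+* AddMonoid.End X := f.liftOfSurjective hf
    ⟨Module.toAddMonoidEnd R X, fun r hr => AddMonoidHom.ext fun x => hX r hr x⟩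
  have hφ (r : R) (x : X) : φ (f r) x = r • x :=
    DFunLike.congr_fun (f.liftOfRightInverse_comp_apply _ (Function.rightInverse_surjInv hf)
      ⟨Module.toAddMonoidEnd R X, fun r hr => AddMonoidHom.ext fun x => hX r hr x⟩ r) x
  let _ : Module S X := Module.compHom X φ
  let e : (ModuleCat.restrictScalars f).obj (ModuleCat.of S X) ≃ₗ[R] X :=
    { AddEquiv.refl X with map_smul' := fun r x => hφ r x }
  exact ⟨ModuleCat.of S X, ⟨e.toModuleIso⟩⟩

end ProjectiveDimension

/-! ### Modules over the corner algebra -/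

namespace CornerAlgebra

variable {A B M : Type u} [Ring A] [Ring B] [AddCommGroup M] [Module B M] [Module Aᵐᵒᵖ M]
  [SMulCommClass B Aᵐᵒᵖ M]

variable (A B M) in
/-- The projection of the corner algebra to its upper left entry. -/
def aHom : CornerAlgebra A B M →+* A where
  toFun := a
  map_zero' := rfl
  map_one' := rfl
  map_add' _ _ := rfl
  map_mul' _ _ := rfl

variable (A B M) in
/-- The projection of the corner algebra to its lower right entry. -/
def bHom : CornerAlgebra A B M →+* B where
  toFun := b
  map_zero' := rfl
  map_one' := rfl
  map_add' _ _ := rfl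
  map_mul' _ _ := rfl

theorem aHom_surjective : Function.Surjective (aHom A B M) := fun a => ⟨⟨a, 0, 0⟩, rfl⟩

theorem bHom_surjective : Function.Surjective (bHom A B M) := fun b => ⟨⟨0, 0, b⟩, rfl⟩

/-- The second column `⟨0, 0, b⟩` is a left ideal on which `Λ` acts through `B`, so composing a
`B`-linear section of `B^(P) → P` with its inclusion, coordinate by coordinate, gives a `Λ`-linear
section of `Λ^(P) → P`. -/
theorem projective_restrictScalars_bHom (P : ModuleCat.{u} B) (hP : Projective P) :
    Projective ((ModuleCat.restrictScalars (bHom A B M)).obj P) := by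
  have : Module.Projective B P := inferInstance
  obtain ⟨s, hs⟩ := Module.projective_def'.1 this
  let _ : Module (CornerAlgebra A B M) P := Module.compHom P (bHom A B M)
  let j : B →+ CornerAlgebra A B M :=
    { toFun := fun b => ⟨0, 0, b⟩
      map_zero' := rfl
      map_add' := fun x y => by ext <;> simp }
  have : Module.Projective (CornerAlgebra A B M) P := by
    refine ⟨{ toFun := fun p => Finsupp.mapRange j j.map_zero (s p)
              map_add' := fun x y => ?_
              map_smul' := fun r x => ?_ }, fun p => ?_⟩
    · rw [map_add, Finsupp.mapRange_add j.map_add]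
    · have h : s (r • x) = r.b • s x := s.map_smul r.b x
      rw [h]
      ext i <;> simp [j]
    · have h := DFunLike.congr_fun hs p
      change Finsupp.linearCombination B id (s p) = p at h
      conv_rhs => rw [← h]
      change Finsupp.linearCombination (CornerAlgebra A B M) id
        (Finsupp.mapRange j j.map_zero (s p)) = _
      rw [Finsupp.linearCombination_apply, Finsupp.linearCombination_apply,
        Finsupp.sum_mapRange_index (fun i => zero_smul (CornerAlgebra A B M) i)]
      rfl
  exact (IsProjective.iff_projective (R := CornerAlgebra A B M) P).1 this

theorem hasProjectiveDimensionLT_of_ker_bHom {n : ℕ}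
    (hB : ∀ X : ModuleCat.{u} B, HasProjectiveDimensionLT X n)
    (X : ModuleCat.{u} (CornerAlgebra A B M))
    (hX : ∀ r : CornerAlgebra A B M, r.b = 0 → ∀ x : X, r • x = 0) :
    HasProjectiveDimensionLT X n := by
  obtain ⟨Y, ⟨e⟩⟩ := exists_restrictScalars_iso (bHom A B M) bHom_surjective X hX
  have := hasProjectiveDimensionLT_restrictScalars (bHom A B M) (d := 0)
    (fun P hP => have := projective_restrictScalars_bHom (A := A) (M := M) P hP; inferInstance)
    n Y (hB Y)
  rw [zero_add] at this
  exact hasProjectiveDimensionLT_of_iso e n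

/-- Restricted to the corner algebra, a projective `A`-module is a retract of a module `A^(P)`,
which is the quotient of a free module by a module over `B`. -/
theorem hasProjectiveDimensionLT_restrictScalars_aHom {n : ℕ}
    (hB : ∀ X : ModuleCat.{u} B, HasProjectiveDimensionLT X n)
    (P : ModuleCat.{u} A) (hP : Projective P) :
    HasProjectiveDimensionLT ((ModuleCat.restrictScalars (aHom A B M)).obj P) (n + 1) := by
  have : Module.Projective A P := inferInstance
  obtain ⟨s, hs⟩ := Module.projective_def'.1 this
  let F := ModuleCat.restrictScalars.{u} (aHom A B M)
  have hr : Retract P (ModuleCat.of A (P →₀ A)) :=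
    { i := ModuleCat.ofHom s
      r := ModuleCat.ofHom (Finsupp.linearCombination A id)
      retract := by ext x; exact DFunLike.congr_fun hs x }
  let _ : Module (CornerAlgebra A B M) (P →₀ A) := Module.compHom _ (aHom A B M)
  let g : (P →₀ CornerAlgebra A B M) →ₗ[CornerAlgebra A B M] (P →₀ A) :=
    { toFun := Finsupp.mapRange a rfl
      map_add' := Finsupp.mapRange_add fun _ _ => rfl
      map_smul' := fun r x => Finsupp.ext fun i => rfl }
  have hg : Function.Surjective g :=
    Finsupp.mapRange_surjective _ rfl aHom_surjective
  have h₁ : HasProjectiveDimensionLT g.shortComplexKer.X₁ n := by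
    -- Coordinates of kernel elements have the form `⟨0, m, b⟩`, and `r * ⟨0, m, b⟩ = ⟨0, r.b • m,
    -- r.b * b⟩`.
    refine hasProjectiveDimensionLT_of_ker_bHom hB _ fun r hr x => Subtype.ext ?_
    refine Finsupp.ext fun i => ?_
    have hx : (x.1 i).a = 0 := DFunLike.congr_fun x.2 i
    change r * x.1 i = 0
    ext <;> simp [hx, hr]
  have h₂ : Projective g.shortComplexKer.X₂ :=
    (IsProjective.iff_projective (R := CornerAlgebra A B M) _).1 inferInstance
  have h₃ := (LinearMap.shortExact_shortComplexKer hg).hasProjectiveDimensionLT_X₃ n h₁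
    (hasProjectiveDimensionLT_of_ge _ 1 _ (by lia))
  have : HasProjectiveDimensionLT (F.obj (ModuleCat.of A (P →₀ A))) (n + 1) := h₃
  exact (hr.map F).hasProjectiveDimensionLT (n + 1)

theorem hasProjectiveDimensionLT_of_ker_aHom {m n : ℕ}
    (hA : ∀ X : ModuleCat.{u} A, HasProjectiveDimensionLT X m)
    (hB : ∀ X : ModuleCat.{u} B, HasProjectiveDimensionLT X n)
    (X : ModuleCat.{u} (CornerAlgebra A B M))
    (hX : ∀ r : CornerAlgebra A B M, r.a = 0 → ∀ x : X, r • x = 0) :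
    HasProjectiveDimensionLT X (n + m) := by
  obtain ⟨Y, ⟨e⟩⟩ := exists_restrictScalars_iso (aHom A B M) aHom_surjective X hX
  have := hasProjectiveDimensionLT_restrictScalars (aHom A B M)
    (hasProjectiveDimensionLT_restrictScalars_aHom hB) m Y (hA Y)
  exact hasProjectiveDimensionLT_of_iso e (n + m)

variable (A B M) in
/-- The lower part of a module over the corner algebra: the elements killed by `!![1, 0; 0, 0]`. -/
def lowerPart (X : Type u) [AddCommGroup X] [Module (CornerAlgebra A B M) X] :
    Submodule (CornerAlgebra A B M) X where
  carrier := {x | (⟨1, 0, 0⟩ : CornerAlgebra A B M) • x = 0}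
  zero_mem' := smul_zero _
  add_mem' {x y} hx hy := by
    rw [Set.mem_ofPred_eq] at *
    rw [smul_add, hx, hy, add_zero]
  smul_mem' r x hx := by
    rw [Set.mem_ofPred_eq] at *
    -- The upper right corner is zero, so `e * r` lies in `Λe`.
    have h : (⟨1, 0, 0⟩ : CornerAlgebra A B M) * r = ⟨r.a, 0, 0⟩ * ⟨1, 0, 0⟩ := by
      ext <;> simp
    rw [← mul_smul, h, mul_smul, hx, smul_zero]

theorem hasProjectiveDimensionLT {m n : ℕ}
    (hA : ∀ X : ModuleCat.{u} A, HasProjectiveDimensionLT X m)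
    (hB : ∀ X : ModuleCat.{u} B, HasProjectiveDimensionLT X n)
    (X : ModuleCat.{u} (CornerAlgebra A B M)) : HasProjectiveDimensionLT X (n + m) := by
  let L := lowerPart A B M X
  let T := ModuleCat.shortComplexOfCompEqZero L.subtype L.mkQ (by ext x; simp)
  have hT : T.ShortExact := ModuleCat.shortComplex_shortExact T
    (LinearMap.exact_subtype_mkQ L) L.injective_subtype L.mkQ_surjective
  refine hT.hasProjectiveDimensionLT_X₂ (n + m) ?_ ?_
  · have : HasProjectiveDimensionLT T.X₁ n := by
      refine hasProjectiveDimensionLT_of_ker_bHom hB _ fun r hr x => Subtype.ext ?_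
      have hx : (⟨1, 0, 0⟩ : CornerAlgebra A B M) • x.1 = 0 := x.2
      -- If `r.b = 0`, then `r` lies in the first column `Λe`, which kills `L`.
      have h : r = r * ⟨1, 0, 0⟩ := by ext <;> simp [hr]
      change r • x.1 = 0
      rw [h, mul_smul, hx, smul_zero]
    exact hasProjectiveDimensionLT_of_ge _ n _ (by lia)
  · refine hasProjectiveDimensionLT_of_ker_aHom hA hB _ fun r hr x => ?_
    obtain ⟨x, rfl⟩ := L.mkQ_surjective x
    refine (L.mkQ.map_smul r x).symm.trans ((Submodule.Quotient.mk_eq_zero L).2 ?_)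
    change (⟨1, 0, 0⟩ : CornerAlgebra A B M) • r • x = 0
    -- If `r.a = 0`, the top row of `r` vanishes, so `r` maps `X` into `L`.
    have h : (⟨1, 0, 0⟩ : CornerAlgebra A B M) * r = 0 := by ext <;> simp [hr]
    rw [← mul_smul, h, zero_smul]

end CornerAlgebra

theorem mainTheorem10 {k : Type v} [Field k] {A B M : Type u}
    [Ring A] [Algebra k A] [Ring B] [Algebra k B]
    [AddCommGroup M] [Module k M] [Module B M] [Module Aᵐᵒᵖ M]
    [SMulCommClass B Aᵐᵒᵖ M] [IsScalarTower k B M] [IsScalarTower k Aᵐᵒᵖ M]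
    (hfd : FiniteDimensional k (CornerAlgebra A B M))
    (hA : IsSmoothAlgebra k A) (hB : IsSmoothAlgebra k B) :
    IsSmoothAlgebra k (CornerAlgebra A B M) := by
  obtain ⟨m, hm⟩ := leftGlobalDimension_lt_top_iff.1 hA.globalDimension_lt_top
  obtain ⟨n, hn⟩ := leftGlobalDimension_lt_top_iff.1 hB.globalDimension_lt_top
  exact ⟨hfd, leftGlobalDimension_lt_top_iff.2
    ⟨n + m, CornerAlgebra.hasProjectiveDimensionLT hm hn⟩⟩
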